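/- A permutation of length $n\ge 0$ is a rearrangement of $1,\dots,n$, written in one-line notation; it contains a permutation $\beta$ if some subsequence of it is order isomorphic to $\beta$, and $\operatorname{Av}(B)$ is the set of permutations that contain no element of $B$. A vertical alternation is a permutation in which all entries at even indices lie above all entries at odd indices, or vice versa. A configuration is a word consisting of the entries of a permutation and of zero or more slots $\diamond$, no two slots being adjacent; permutations are the slotless configurations, and the length of a configuration is its length as a word (entries and slots). A new maximum entry $x$ can be inserted into the $i$th slot from the left in four ways, denoted $\mathbf m_i,\mathbf l_i,\mathbf r_i,\mathbf f_i$: the slot $\diamond$ is replaced by $\diamond x\diamond$, $x\diamond$, $\diamond x$ or $x$, respectively. The insertion encoding of a nonempty permutation is the unique word in these symbols that builds it from the configuration $\diamond$; the insertion encoding of $\operatorname{Av}(B)$ is the language of the insertion encodings of its nonempty elements. It is called regular if it uses only finitely many symbols and is a regular language over a finite alphabet containing them. A configuration is valid for $\operatorname{Av}(B)$ if some sequence of insertions leads from it to a permutation in $\operatorname{Av}(B)$. An entry of a valid configuration $c$ is IE-reducible (relative to $B$) if deleting it from $c$ and relabelling the remaining entries order-preservingly by $1,2,\dots$ (slots being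 kept) gives a configuration $c'$ (in particular no two slots become adjacent) such that, for every word $w$ of insertions, $w$ leads from $c$ to a permutation in $\operatorname{Av}(B)$ if and only if $w$ leads from $c'$ to a permutation in $\operatorname{Av}(B)$. Theorem. For every finite set $B$ of permutations, the following are equivalent: (1) $\operatorname{Av}(B)$ contains only finitely many vertical alternations; (2) there is an integer $k$ such that no valid configuration for $\operatorname{Av}(B)$ has more than $k$ slots; (3) there is an integer $N$ such that every valid configuration for $\operatorname{Av}(B)$ of length at least $N$ contains an IE-reducible entry; (4) the insertion encoding of $\operatorname{Av}(B)$ is regular. -/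

import Mathlib

namespace InsEnc

/-! ## Permutations and pattern containment -/

/-- A permutation of length `n` in one-line notation: a list that rearranges `1, 2, …, n`. -/
def IsPermutation (p : List ℕ) : Prop :=
  p.Perm (List.range' 1 p.length)

/-- Two sequences are order isomorphic if they have the same length and the same pairwise
comparisons. -/
def OrderIsomorphic (s t : List ℕ) : Prop :=
  s.length = t.length ∧
    ∀ (i j : ℕ) (hi : i < s.length) (hj : j < s.length) (hi2 : i < t.length) (hj2 : j < t.length),
      s[i] < s[j] ↔ t[i] < t[j]

/-- `p` contains `q`: some subsequence of `p` is order isomorphic to `q`. -/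
def Contains (p q : List ℕ) : Prop :=
  ∃ s : List ℕ, s.Sublist p ∧ OrderIsomorphic s q

/-- The class of all permutations that avoid every element of `B`. -/
def Av (B : Set (List ℕ)) : Set (List ℕ) :=
  {p | IsPermutation p ∧ ∀ q ∈ B, ¬ Contains p q}

/-- A permutation in which every entry at an index of one parity lies above every entry at an
index of the other parity. -/
def IsVerticalAlternation (p : List ℕ) : Prop :=
  IsPermutation p ∧
    ((∀ (i j : ℕ) (hi : i < p.length) (hj : j < p.length), Even i → Odd j → p[j] < p[i]) ∨
     (∀ (i j : ℕ) (hi : i < p.length) (hj : j < p.length), Even i → Odd j → p[i] < p[j]))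

/-! ## Configurations -/

/-- Words in entries and slots: `some x` is the entry `x`, and `none` is a slot `◇`. -/
abbrev SlotWord := List (Option ℕ)

/-- A configuration is a permutation interspersed with slots, no two of which are adjacent.
(`reduceOption` erases the slots.) -/
def IsConfiguration (c : SlotWord) : Prop :=
  IsPermutation c.reduceOption ∧ c.IsChain (fun x y => ¬ (x = none ∧ y = none))

/-- The number of slots. -/
def slots (c : SlotWord) : ℕ := c.count none

/-- The permutation `p`, as a slotless configuration. -/
def ofPerm (p : List ℕ) : SlotWord := p.map some

/-- Standardization: every entry is replaced by its rank among the entries, and slots are kept. -/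
def st (c : SlotWord) : SlotWord :=
  c.map (Option.map fun x => (c.reduceOption.filter (fun y => y < x)).length + 1)

/-- The four types of insertion. -/
inductive Op
  | m
  | l
  | r
  | f
  deriving DecidableEq

/-- What a slot is replaced by when the new entry `x` is inserted into it. -/
def Op.block : Op → ℕ → SlotWord
  | Op.m, x => [none, some x, none]
  | Op.l, x => [some x, none]
  | Op.r, x => [none, some x]
  | Op.f, x => [some x]

/-- The symbol `(o, i)` stands for an insertion of type `o` into the `i`th slot from the left,
slots being numbered from `1`. -/
abbrev Letter := Op × ℕ

/-- `d` arises from `c` by the insertion `a` of a new maximum entry. -/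
def Step (c : SlotWord) (a : Letter) (d : SlotWord) : Prop :=
  ∃ u v : SlotWord, c = u ++ none :: v ∧ slots u + 1 = a.2 ∧
    d = u ++ a.1.block (c.reduceOption.length + 1) ++ v

/-- The insertions in the word `w`, carried out one after another, lead from `c` to `d`. -/
def Run : SlotWord → List Letter → SlotWord → Prop
  | c, [], d => c = d
  | c, a :: w, d => ∃ e, Step c a e ∧ Run e w d

/-! ## The insertion encoding -/

/-- `w` leads from `c` to an accept state, i.e. to a permutation in `Av(B)`. -/
def Accepts (B : Set (List ℕ)) (c : SlotWord) (w : List Letter) : Prop :=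
  ∃ p ∈ Av B, Run c w (ofPerm p)

/-- A configuration is valid for `Av(B)` if it can be filled to a permutation in `Av(B)`. -/
def IsValid (B : Set (List ℕ)) (c : SlotWord) : Prop :=
  IsConfiguration c ∧ ∃ w, Accepts B c w

/-- No word leads to an accept state from exactly one of `c` and `d`. -/
def Indistinguishable (B : Set (List ℕ)) (c d : SlotWord) : Prop :=
  ∀ w, Accepts B c w ↔ Accepts B d w

/-- The symbol of `s` at index `i` is an entry, and is IE-reducible: deleting it and standardizing
gives a configuration that is indistinguishable from `s`. (An entry between two slots is never
IE-reducible: its deletion does not leave a configuration with the same number of slots.) -/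
def IEReducible (B : Set (List ℕ)) (s : SlotWord) (i : ℕ) : Prop :=
  (∃ x : ℕ, s[i]? = some (some x)) ∧
    IsConfiguration (st (s.eraseIdx i)) ∧
    Indistinguishable B s (st (s.eraseIdx i))

/-- `w` is the insertion encoding of the permutation `p`: it builds `p` from the single slot. -/
def Encodes (w : List Letter) (p : List ℕ) : Prop :=
  Run [none] w (ofPerm p)

/-- The insertion encoding of `Av(B)`: the language of the encodings of all its elements. -/
def insertionEncoding (B : Set (List ℕ)) : Language Letter :=
  {w | ∃ p ∈ Av B, Encodes w p}

/-- A language whose words use only finitely many symbols, and which is regular as a language over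
such a finite alphabet. -/
def IsRegularOverFinite {α : Type*} (L : Language α) : Prop :=
  ∃ (A : Finset α) (M : Language A), M.IsRegular ∧ Language.map Subtype.val M = L

end InsEnc

namespace InsEnc

/-! ## Patterns -/

/-! Entries present in a configuration are low, and whatever is inserted later is high. If a valid
configuration has k + 1 slots, then between consecutive slots lies a low entry and each slot
eventually receives a high one, so its completion in the class contains a vertical alternation of
length 2k (`IsValid.exists_verticalAlternation`). Conversely, if the construction of a vertical
alternation is stopped once all its low entries are present, then the high entries still missing are
separated by low ones and need different slots (`IsVerticalAlternation.exists_isValid`). This gives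
(1) ⇔ (2).

For (2) ⇒ (3), let l bound the lengths of the patterns in `B`. An occurrence of a pattern uses a set
S of at most l old entries, and only the standardized configuration formed by S and all slots
matters. With boundedly many slots there are finitely many such types. Choose one representative set
for each type; an old entry outside all representatives, not directly followed by a slot, is
IE-reducible (`indistinguishable_st_keep`, `exists_ieReducible_of_slots_le`).

For (3) ⇒ (4), repeated deletion makes every valid configuration indistinguishable from one of
bounded length, and Myhill–Nerode applies. For (4) ⇒ (2), finitely many left quotients bound the
length of a shortest completion of a valid configuration, and an insertion removes at most one slot.
-/

theorem OrderIsomorphic.symm {s t : List ℕ} (h : OrderIsomorphic s t) : OrderIsomorphic t s :=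
  ⟨h.1.symm, fun i j hi hj hi2 hj2 => (h.2 i j hi2 hj2 hi hj).symm⟩

theorem OrderIsomorphic.trans {s t u : List ℕ} (h : OrderIsomorphic s t)
    (h' : OrderIsomorphic t u) : OrderIsomorphic s u :=
  ⟨h.1.trans h'.1, fun i j hi hj hi2 hj2 =>
    (h.2 i j hi hj (h.1 ▸ hi) (h.1 ▸ hj)).trans (h'.2 i j _ _ hi2 hj2)⟩

theorem orderIsomorphic_map {f : ℕ → ℕ} {s : List ℕ} (hf : StrictMonoOn f {x | x ∈ s}) :
    OrderIsomorphic (s.map f) s := by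
  refine ⟨List.length_map .., fun i j hi hj hi2 hj2 => ?_⟩
  rw [List.getElem_map, List.getElem_map]
  exact hf.lt_iff_lt (List.getElem_mem hi2) (List.getElem_mem hj2)

/-- A monotone relabelling of a subsequence contains nothing new. -/
theorem Contains.of_map_sublist {f : ℕ → ℕ} {s p q : List ℕ} (hf : StrictMonoOn f {x | x ∈ s})
    (hs : s.Sublist p) (h : Contains (s.map f) q) : Contains p q := by
  obtain ⟨t, ht, hq⟩ := h
  obtain ⟨t', ht', rfl⟩ := List.sublist_map_iff.1 ht
  exact ⟨t', ht'.trans hs, (orderIsomorphic_map (hf.mono fun x hx => ht'.subset hx)).symm.trans hq⟩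

theorem mem_Av_of_map_sublist {B : Set (List ℕ)} {f : ℕ → ℕ} {s p : List ℕ}
    (hf : StrictMonoOn f {x | x ∈ s}) (hs : s.Sublist p) (hp : p ∈ Av B)
    (h : IsPermutation (s.map f)) : s.map f ∈ Av B :=
  ⟨h, fun q hq hc => hp.2 q hq (hc.of_map_sublist hf hs)⟩

theorem IsPermutation.nodup {p : List ℕ} (h : IsPermutation p) : p.Nodup :=
  h.nodup_iff.2 List.nodup_range'

theorem IsPermutation.mem_iff {p : List ℕ} (h : IsPermutation p) {x : ℕ} :
    x ∈ p ↔ 1 ≤ x ∧ x ≤ p.length := by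
  rw [List.Perm.mem_iff h, List.mem_range'_1]; omega

theorem isPermutation_of_nodup {p : List ℕ} (h : p.Nodup)
    (h' : ∀ x ∈ p, 1 ≤ x ∧ x ≤ p.length) : IsPermutation p := by
  refine (List.subperm_of_subset h fun x hx => ?_).perm_of_length_le (by simp)
  rw [List.mem_range'_1]
  have := h' x hx
  omega

/-- The rank of `x` among the elements of `l`. -/
def rank (l : List ℕ) (x : ℕ) : ℕ := (l.filter (fun y => y < x)).length + 1

theorem strictMonoOn_rank (l : List ℕ) : StrictMonoOn (rank l) {x | x ∈ l} := by
  intro x hx y hy hxy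
  unfold rank
  refine Nat.succ_lt_succ ?_
  have hsub : (l.filter (fun z => z < x)).Sublist (l.filter (fun z => z < y)) := by
    refine List.monotone_filter_right l fun z hz => ?_
    simp only [decide_eq_true_eq] at hz ⊢
    omega
  refine lt_of_le_of_ne hsub.length_le fun h => ?_
  have := hsub.eq_of_length h
  have hx' : x ∈ l.filter (fun z => z < y) := List.mem_filter.2 ⟨hx, by simpa using hxy⟩
  rw [← this, List.mem_filter] at hx'
  simp at hx'

theorem one_le_rank (l : List ℕ) (x : ℕ) : 1 ≤ rank l x := by simp [rank]

theorem rank_le_length {l : List ℕ} {x : ℕ} (hx : x ∈ l) : rank l x ≤ l.length := by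
  unfold rank
  refine Nat.succ_le_of_lt (List.length_filter_lt_length_iff_exists.2 ⟨x, hx, by simp⟩)

theorem isPermutation_map_rank {l : List ℕ} (h : l.Nodup) : IsPermutation (l.map (rank l)) := by
  refine isPermutation_of_nodup ((List.nodup_map_iff_inj_on h).2 fun x hx y hy hxy =>
    (strictMonoOn_rank l).injOn hx hy hxy) ?_
  simp only [List.length_map, List.mem_map, forall_exists_index, and_imp, forall_apply_eq_imp_iff₂]
  exact fun x hx => ⟨one_le_rank l x, rank_le_length hx⟩

/-! ## Slot words -/

@[simp] theorem slots_nil : slots [] = 0 := rfl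
@[simp] theorem slots_cons_none (c : SlotWord) : slots (none :: c) = slots c + 1 := by simp [slots]
@[simp] theorem slots_cons_some (x : ℕ) (c : SlotWord) : slots (some x :: c) = slots c := by
  simp [slots]
@[simp] theorem slots_append (c d : SlotWord) : slots (c ++ d) = slots c + slots d :=
  List.count_append

theorem length_eq_slots_add (c : SlotWord) : c.length = slots c + c.reduceOption.length := by
  induction c with
  | nil => rfl
  | cons o c ih => cases o <;> simp [ih, List.reduceOption_cons_of_none] <;> omega

@[simp] theorem slots_ofPerm (p : List ℕ) : slots (ofPerm p) = 0 := by
  induction p with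
  | nil => rfl
  | cons x p ih => simpa [ofPerm] using ih

@[simp] theorem reduceOption_ofPerm (p : List ℕ) : (ofPerm p).reduceOption = p := by
  induction p with
  | nil => rfl
  | cons x p ih => simpa [ofPerm] using ih

theorem eq_ofPerm_of_slots {c : SlotWord} (h : slots c = 0) : c = ofPerm c.reduceOption := by
  induction c with
  | nil => rfl
  | cons o c ih =>
    cases o with
    | none => simp at h
    | some x => simpa [ofPerm] using ih (by simpa using h)

theorem exists_eq_append_none {c : SlotWord} {i : ℕ} (h : i < slots c) :
    ∃ u v, c = u ++ none :: v ∧ slots u = i := by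
  induction c generalizing i with
  | nil => simp at h
  | cons o c ih =>
    cases o with
    | none =>
      cases i with
      | zero => exact ⟨[], c, rfl, rfl⟩
      | succ i =>
        obtain ⟨u, v, rfl, hu⟩ := ih (i := i) (by simpa using h)
        exact ⟨none :: u, v, rfl, by simp [hu]⟩
    | some x =>
      obtain ⟨u, v, rfl, hu⟩ := ih (i := i) (by simpa using h)
      exact ⟨some x :: u, v, rfl, by simp [hu]⟩

theorem append_none_inj {u u' v v' : SlotWord} (h : u ++ none :: v = u' ++ none :: v')
    (hs : slots u = slots u') : u = u' ∧ v = v' := by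
  induction u generalizing u' with
  | nil =>
    cases u' with
    | nil => simpa using h
    | cons o u' =>
      obtain ⟨rfl, -⟩ : none = o ∧ _ := by simpa using h
      simp at hs
  | cons o u ih =>
    cases u' with
    | nil =>
      obtain ⟨rfl, -⟩ : o = none ∧ _ := by simpa using h
      simp at hs
    | cons o' u' =>
      obtain ⟨rfl, htl⟩ := List.cons.inj h
      have : slots u = slots u' := by cases o <;> simpa using hs
      obtain ⟨rfl, rfl⟩ := ih htl this
      exact ⟨rfl, rfl⟩

/-! ## Insertion of explicit values -/

@[simp] theorem reduceOption_block (o : Op) (x : ℕ) : (o.block x).reduceOption = [x] := by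
  cases o <;> rfl

theorem slots_block_eq (o : Op) (x y : ℕ) : slots (o.block x) = slots (o.block y) := by
  cases o <;> simp [Op.block]

/-- `d` arises from `c` by the insertion `a`, the new entry being `x`. -/
def Ins (c : SlotWord) (a : Letter) (x : ℕ) (d : SlotWord) : Prop :=
  ∃ u v : SlotWord, c = u ++ none :: v ∧ slots u + 1 = a.2 ∧ d = u ++ a.1.block x ++ v

/-- The insertions in `w` lead from `c` to `d`, the new entries being `n + 1, n + 2, …`. -/
def InsRun : SlotWord → List Letter → ℕ → SlotWord → Prop
  | c, [], _, d => c = d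
  | c, a :: w, n, d => ∃ e, Ins c a (n + 1) e ∧ InsRun e w (n + 1) d

theorem Ins.reduceOption_perm {c d : SlotWord} {a : Letter} {x : ℕ} (h : Ins c a x d) :
    d.reduceOption.Perm (x :: c.reduceOption) := by
  obtain ⟨u, v, rfl, -, rfl⟩ := h
  simp only [List.reduceOption_append, reduceOption_block, List.reduceOption_cons_of_none]
  simp

theorem Ins.length_reduceOption {c d : SlotWord} {a : Letter} {x : ℕ} (h : Ins c a x d) :
    d.reduceOption.length = c.reduceOption.length + 1 := by
  simpa using h.reduceOption_perm.length_eq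

/-- `Run` ties each new value to the current number of entries. `InsRun` frees the counter, so that
old entries can be deleted or relabelled without disturbing the run. -/
theorem run_iff_insRun {c d : SlotWord} {w : List Letter} :
    Run c w d ↔ InsRun c w c.reduceOption.length d := by
  induction w generalizing c with
  | nil => rfl
  | cons a w ih =>
    refine exists_congr fun e => and_congr_right fun h => ?_
    rw [ih, Ins.length_reduceOption h]

theorem Ins.unique {c d d' : SlotWord} {a : Letter} {x : ℕ} (h : Ins c a x d) (h' : Ins c a x d') :
    d = d' := by
  obtain ⟨u, v, rfl, hu, rfl⟩ := h
  obtain ⟨u', v', he, hu', rfl⟩ := h'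
  obtain ⟨rfl, rfl⟩ := append_none_inj he (by omega)
  rfl

theorem InsRun.unique {c d d' : SlotWord} {w : List Letter} {n : ℕ} (h : InsRun c w n d)
    (h' : InsRun c w n d') : d = d' := by
  induction w generalizing c n with
  | nil => exact Eq.trans (Eq.symm h) h'
  | cons a w ih =>
    obtain ⟨e, he, h⟩ := h
    obtain ⟨e', he', h'⟩ := h'
    obtain rfl := he.unique he'
    exact ih h h'

/-- Whether insertions can be carried out depends only on the number of slots. -/
theorem InsRun.exists_of_slots_eq {c c' d : SlotWord} {w : List Letter} {n : ℕ}
    (h : InsRun c w n d) (n' : ℕ) (hs : slots c' = slots c) :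
    ∃ d', InsRun c' w n' d' ∧ slots d' = slots d := by
  induction w generalizing c c' n n' with
  | nil => exact ⟨c', rfl, h ▸ hs⟩
  | cons a w ih =>
    obtain ⟨e, ⟨u, v, rfl, hu, rfl⟩, h⟩ := h
    simp only [slots_append, slots_cons_none] at hs
    obtain ⟨u', v', rfl, hu'⟩ := exists_eq_append_none (c := c') (i := slots u) (by omega)
    simp only [slots_append, slots_cons_none] at hs
    obtain ⟨d', hd', hs'⟩ := ih h (c' := u' ++ a.1.block (n' + 1) ++ v') (n' + 1) (by
      simp only [slots_append, slots_block_eq a.1 (n' + 1) (n + 1)]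
      omega)
    exact ⟨d', ⟨_, ⟨u', v', rfl, by omega, rfl⟩, hd'⟩, hs'⟩

theorem InsRun.slots_le {c d : SlotWord} {w : List Letter} {n : ℕ} (h : InsRun c w n d) :
    slots c ≤ slots d + w.length := by
  induction w generalizing c n with
  | nil => obtain rfl : c = d := h; simp
  | cons a w ih =>
    obtain ⟨e, ⟨u, v, rfl, hu, rfl⟩, h⟩ := h
    have := ih h
    simp only [slots_append, slots_cons_none, List.length_cons] at *
    omega

theorem run_append {c d : SlotWord} {w w' : List Letter} :
    Run c (w ++ w') d ↔ ∃ e, Run c w e ∧ Run e w' d := by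
  induction w generalizing c with
  | nil => simp [Run]
  | cons a w ih =>
    simp only [List.cons_append, Run, ih]
    aesop

theorem Run.unique {c d d' : SlotWord} {w : List Letter} (h : Run c w d) (h' : Run c w d') :
    d = d' :=
  (run_iff_insRun.1 h).unique (run_iff_insRun.1 h')

/-- The slots of `c` and those entries that satisfy `P`. -/
def keep (P : ℕ → Bool) (c : SlotWord) : SlotWord := c.filter fun o => o.elim true P

@[simp] theorem keep_append (P : ℕ → Bool) (c d : SlotWord) :
    keep P (c ++ d) = keep P c ++ keep P d := List.filter_append ..

@[simp] theorem keep_cons_none (P : ℕ → Bool) (c : SlotWord) :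
    keep P (none :: c) = none :: keep P c := rfl

theorem keep_cons_some (P : ℕ → Bool) (x : ℕ) (c : SlotWord) :
    keep P (some x :: c) = if P x then some x :: keep P c else keep P c := by
  cases h : P x <;> simp [keep, h]

@[simp] theorem slots_keep (P : ℕ → Bool) (c : SlotWord) : slots (keep P c) = slots c := by
  induction c with
  | nil => rfl
  | cons o c ih => cases o <;> simp [ih, keep_cons_some]; split <;> simp [ih]

@[simp] theorem reduceOption_keep (P : ℕ → Bool) (c : SlotWord) :
    (keep P c).reduceOption = c.reduceOption.filter P := by
  induction c with
  | nil => rfl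
  | cons o c ih =>
    cases o with
    | none => simp [ih, List.reduceOption_cons_of_none]
    | some x => rw [keep_cons_some]; split <;> simp_all

theorem keep_ofPerm (P : ℕ → Bool) (p : List ℕ) : keep P (ofPerm p) = ofPerm (p.filter P) := by
  rw [eq_ofPerm_of_slots (c := keep P (ofPerm p)) (by simp)]; simp

theorem keep_block {P : ℕ → Bool} {x : ℕ} (h : P x = true) (o : Op) :
    keep P (o.block x) = o.block x := by
  cases o <;> simp [Op.block, keep, h]

/-- Letters count slots only, so deleting old entries commutes with insertions as long as all new
entries survive. -/
theorem InsRun.keep {c d : SlotWord} {w : List Letter} {n : ℕ} (h : InsRun c w n d)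
    {P : ℕ → Bool} (hP : ∀ x, n < x → P x = true) : InsRun (keep P c) w n (keep P d) := by
  induction w generalizing c n with
  | nil => exact congrArg _ h
  | cons a w ih =>
    obtain ⟨e, ⟨u, v, rfl, hu, rfl⟩, h⟩ := h
    refine ⟨_, ⟨InsEnc.keep P u, InsEnc.keep P v, by simp, by simpa, rfl⟩, ?_⟩
    simpa [keep_block (hP (n + 1) (by omega))] using ih h fun x hx => hP x (by omega)

@[simp] theorem slots_map (f : ℕ → ℕ) (c : SlotWord) : slots (c.map (Option.map f)) = slots c := by
  induction c with
  | nil => rfl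
  | cons o c ih => cases o <;> simp [ih]

theorem map_ofPerm (f : ℕ → ℕ) (p : List ℕ) : (ofPerm p).map (Option.map f) = ofPerm (p.map f) := by
  simp [ofPerm]

theorem InsRun.map {c d : SlotWord} {w : List Letter} {n m : ℕ} (h : InsRun c w n d)
    {f : ℕ → ℕ} (hf : ∀ j, f (n + 1 + j) = m + 1 + j) :
    InsRun (c.map (Option.map f)) w m (d.map (Option.map f)) := by
  induction w generalizing c n m with
  | nil => exact congrArg _ h
  | cons a w ih =>
    obtain ⟨e, ⟨u, v, rfl, hu, rfl⟩, h⟩ := h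
    refine ⟨_, ⟨u.map (Option.map f), v.map (Option.map f), by simp, by simpa, rfl⟩, ?_⟩
    have hb : (a.1.block (n + 1)).map (Option.map f) = a.1.block (m + 1) := by
      have := hf 0
      cases a.1 <;> simpa [Op.block] using this
    have := ih h (m := m + 1) fun j => by
      have := hf (j + 1)
      rw [show n + 1 + 1 + j = n + 1 + (j + 1) by omega, this]; omega
    simpa [hb] using this

/-- Entries of the result of a run are old or new. -/
theorem InsRun.mem {c d : SlotWord} {w : List Letter} {n : ℕ} (h : InsRun c w n d) {x : ℕ}
    (hx : x ∈ d.reduceOption) : x ∈ c.reduceOption ∨ n < x := by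
  induction w generalizing c n with
  | nil => obtain rfl : c = d := h; exact Or.inl hx
  | cons a w ih =>
    obtain ⟨e, he, h⟩ := h
    rcases ih h with h | h
    · rw [he.reduceOption_perm.mem_iff, List.mem_cons] at h
      rcases h with rfl | h
      · right; omega
      · exact Or.inl h
    · right; omega

/-! ## Standardization -/

theorem st_eq (c : SlotWord) : st c = c.map (Option.map (rank c.reduceOption)) := rfl

@[simp] theorem slots_st (c : SlotWord) : slots (st c) = slots c := by simp [st_eq]

theorem reduceOption_st (c : SlotWord) :
    (st c).reduceOption = c.reduceOption.map (rank c.reduceOption) := by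
  rw [st_eq, List.reduceOption_map]

/-- Standardizing the start of a run standardizes the whole run. -/
theorem InsRun.st {c d : SlotWord} {w : List Letter} {n : ℕ} (h : InsRun c w n d)
    (hn : ∀ x ∈ c.reduceOption, x ≤ n) :
    ∃ f : ℕ → ℕ, StrictMonoOn f {x | x ∈ d.reduceOption} ∧
      Run (st c) w (d.map (Option.map f)) := by
  -- Old entries go to their ranks; new ones are shifted so as to continue directly after the ranks.
  let g : ℕ → ℕ := fun x => if x ≤ n then rank c.reduceOption x else c.reduceOption.length + (x - n)
  have hg : ∀ x ∈ c.reduceOption, g x = rank c.reduceOption x := fun x hx => if_pos (hn x hx)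
  refine ⟨g, fun x hx y hy hxy => ?_, ?_⟩
  · rcases h.mem hx with hx' | hx'
    · rcases h.mem hy with hy' | hy'
      · rw [hg x hx', hg y hy']
        exact strictMonoOn_rank _ hx' hy' hxy
      · have := rank_le_length hx'
        simp only [hg x hx', g, if_neg (not_le.2 hy')]
        omega
    · simp only [g, if_neg (not_le.2 hx'), if_neg (not_le.2 (hx'.trans hxy))]
      omega
  · have hst : InsEnc.st c = c.map (Option.map g) := by
      rw [st_eq]
      refine List.map_congr_left fun o ho => ?_
      cases o with
      | none => rfl
      | some x => simp [hg x (List.reduceOption_mem_iff.2 ho)]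
    rw [run_iff_insRun, reduceOption_st, List.length_map, hst]
    refine h.map fun j => ?_
    simp only [g, if_neg (show ¬ n + 1 + j ≤ n by omega)]
    omega

/-! ## Configurations -/

/-- No two slots are adjacent. -/
abbrev SlotsApart (c : SlotWord) : Prop := c.IsChain (fun x y => ¬ (x = none ∧ y = none))

theorem slotsApart_append_some {u v : SlotWord} {x : ℕ} :
    SlotsApart (u ++ some x :: v) ↔ SlotsApart u ∧ SlotsApart v := by
  simp [SlotsApart, List.isChain_append, List.isChain_cons]

theorem slotsApart_append_none {u v : SlotWord} :
    SlotsApart (u ++ none :: v) ↔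
      SlotsApart u ∧ SlotsApart v ∧ none ∉ u.getLast? ∧ none ∉ v.head? := by
  simp only [SlotsApart, List.isChain_append, List.isChain_cons, Option.mem_def, List.head?_cons,
    true_and]
  constructor
  · rintro ⟨hu, ⟨hv, hv'⟩, h⟩
    exact ⟨hu, hv', fun e => h _ e _ rfl ⟨rfl, rfl⟩, fun e => hv _ e rfl⟩
  · rintro ⟨hu, hv, h, h'⟩
    refine ⟨hu, ⟨fun y hy e => h' (e ▸ hy), hv⟩, fun x hx y _ e => h (e.1 ▸ hx)⟩

theorem isPermutation_cons_perm {p q : List ℕ} (h : q.Perm ((p.length + 1) :: p)) :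
    IsPermutation q ↔ IsPermutation p := by
  unfold IsPermutation
  rw [h.length_eq, List.length_cons, List.range'_1_concat, h.congr_left,
    (List.perm_append_singleton _ _).congr_right, add_comm 1, List.perm_cons]

theorem IsConfiguration.step {c d : SlotWord} {a : Letter} (hc : IsConfiguration c)
    (h : Step c a d) : IsConfiguration d := by
  refine ⟨(isPermutation_cons_perm (Ins.reduceOption_perm h)).2 hc.1, ?_⟩
  obtain ⟨u, v, rfl, -, rfl⟩ := h
  obtain ⟨hu, hv, hu', hv'⟩ := slotsApart_append_none.1 hc.2
  have hv2 : SlotsApart (none :: v) := (slotsApart_append_none (u := [])).2 ⟨.nil, hv, by simp, hv'⟩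
  have hu2 : SlotsApart (u ++ [none]) := (slotsApart_append_none).2 ⟨hu, .nil, hu', by simp⟩
  generalize (u ++ none :: v).reduceOption.length + 1 = x
  cases a.1 with
  | m => simpa [Op.block] using (slotsApart_append_some (x := x)).2 ⟨hu2, hv2⟩
  | l => simpa [Op.block] using (slotsApart_append_some (x := x)).2 ⟨hu, hv2⟩
  | r => simpa [Op.block] using (slotsApart_append_some (x := x)).2 ⟨hu2, hv⟩
  | f => simpa [Op.block, SlotsApart] using (slotsApart_append_some (x := x)).2 ⟨hu, hv⟩

theorem IsConfiguration.run {c d : SlotWord} {w : List Letter} (hc : IsConfiguration c)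
    (h : Run c w d) : IsConfiguration d := by
  induction w generalizing c with
  | nil => obtain rfl : c = d := h; exact hc
  | cons a w ih =>
    obtain ⟨e, he, h⟩ := h
    exact ih (hc.step he) h

theorem slotsApart_singleton : SlotsApart [none] := by simp [SlotsApart]

theorem isConfiguration_slot : IsConfiguration [none] := ⟨List.Perm.nil, slotsApart_singleton⟩

theorem isConfiguration_ofPerm {p : List ℕ} : IsConfiguration (ofPerm p) ↔ IsPermutation p := by
  rw [IsConfiguration, reduceOption_ofPerm]
  refine and_iff_left ?_
  rw [ofPerm, List.isChain_map]
  simp [List.isChain_iff_getElem]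

/-- A configuration with an entry arises by an insertion: remove the maximum. -/
theorem IsConfiguration.exists_step {d : SlotWord} (hd : IsConfiguration d)
    (h : d.reduceOption ≠ []) : ∃ c a, IsConfiguration c ∧ Step c a d := by
  obtain ⟨n, hn⟩ : ∃ n, d.reduceOption.length = n + 1 :=
    Nat.exists_eq_succ_of_ne_zero (by simpa using h)
  have hmem : n + 1 ∈ d.reduceOption := hd.1.mem_iff.2 (by omega)
  obtain ⟨u, v, hdec⟩ := List.append_of_mem (List.reduceOption_mem_iff.1 hmem)
  obtain ⟨hu, hv⟩ := slotsApart_append_some.1 (hdec ▸ hd.2)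
  suffices key : ∃ (u' v' : SlotWord) (o : Op), d = u' ++ o.block (n + 1) ++ v' ∧
      SlotsApart (u' ++ none :: v') by
    obtain ⟨u', v', o, hd', hc⟩ := key
    have hperm : d.reduceOption.Perm ((n + 1) :: (u' ++ none :: v').reduceOption) := by
      simp only [hd', List.reduceOption_append, reduceOption_block, List.reduceOption_cons_of_none]
      simp
    have hlen : (u' ++ none :: v').reduceOption.length = n := by
      have := hperm.length_eq
      simp only [List.length_cons] at this
      omega
    refine ⟨u' ++ none :: v', (o, slots u' + 1), ⟨?_, hc⟩, u', v', rfl, rfl, by rw [hlen, hd']⟩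
    exact (isPermutation_cons_perm (by rw [hlen]; exact hperm)).1 hd.1
  have hu' : (none ∉ u.getLast?) ∨ ∃ u', u = u' ++ [none] := by
    by_cases h : none ∈ u.getLast?
    · exact Or.inr ⟨u.dropLast, (List.dropLast_append_getLast? _ h).symm⟩
    · exact Or.inl h
  have hv' : (none ∉ v.head?) ∨ ∃ v', v = none :: v' := by
    cases v with
    | nil => simp
    | cons o v => cases o <;> simp
  -- The maximum merges with its neighbouring slots into a single slot. Which neighbours are slots
  -- (none, right, left, both) determines the type `f`, `l`, `r` or `m`.
  rcases hu' with hu' | ⟨u', rfl⟩ <;> rcases hv' with hv' | ⟨v', rfl⟩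
  · exact ⟨u, v, .f, by simp [hdec, Op.block], slotsApart_append_none.2 ⟨hu, hv, hu', hv'⟩⟩
  · have h2 := (slotsApart_append_none (u := [])).1 hv
    exact ⟨u, v', .l, by simp [hdec, Op.block],
      slotsApart_append_none.2 ⟨hu, h2.2.1, hu', h2.2.2.2⟩⟩
  · have h2 := slotsApart_append_none.1 hu
    exact ⟨u', v, .r, by simp [hdec, Op.block],
      slotsApart_append_none.2 ⟨h2.1, hv, h2.2.2.1, hv'⟩⟩
  · have h1 := slotsApart_append_none.1 hu
    have h2 := (slotsApart_append_none (u := [])).1 hv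
    exact ⟨u', v', .m, by simp [hdec, Op.block],
      slotsApart_append_none.2 ⟨h1.1, h2.2.1, h1.2.2.1, h2.2.2.2⟩⟩

/-- Removing the largest entries, one after another, leaves a configuration with `j` entries. -/
theorem IsConfiguration.exists_run {d : SlotWord} (hd : IsConfiguration d) {j : ℕ}
    (hj : j ≤ d.reduceOption.length) :
    ∃ c w, IsConfiguration c ∧ c.reduceOption.length = j ∧ Run c w d := by
  obtain ⟨k, hk⟩ := Nat.exists_eq_add_of_le hj
  induction k generalizing d with
  | zero => exact ⟨d, [], hd, by omega, rfl⟩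
  | succ k ih =>
    obtain ⟨e, a, he, hs⟩ := hd.exists_step (List.ne_nil_of_length_pos (by omega))
    have := Ins.length_reduceOption hs
    obtain ⟨c, w, hc, hcj, hr⟩ := ih he (by omega) (by omega)
    exact ⟨c, w ++ [a], hc, hcj, run_append.2 ⟨e, hr, d, hs, rfl⟩⟩

/-- Removing all entries leaves the empty word or a single slot. The empty word admits no insertion,
so it can only lead to itself. -/
theorem IsConfiguration.reachable {c : SlotWord} (hc : IsConfiguration c) (h : c ≠ []) :
    ∃ w, Run [none] w c := by
  obtain ⟨d, w, hd, hd0, hr⟩ := hc.exists_run (Nat.zero_le _)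
  match d, hd, hd0, hr with
  | [], _, _, hr =>
    cases w with
    | nil => exact absurd (Eq.symm hr) h
    | cons a w => obtain ⟨e, ⟨u, v, h, -⟩, -⟩ := hr; simp at h
  | [none], _, _, hr => exact ⟨w, hr⟩
  | some x :: d, _, hd0, _ => simp at hd0
  | none :: none :: d, hd, _, _ => exact absurd hd.2 (by simp)
  | none :: some x :: d, _, hd0, _ => simp [List.reduceOption_cons_of_none] at hd0

theorem IsConfiguration.mem_iff {c : SlotWord} (hc : IsConfiguration c) {x : ℕ} :
    some x ∈ c ↔ 1 ≤ x ∧ x ≤ c.reduceOption.length := by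
  rw [← List.reduceOption_mem_iff, hc.1.mem_iff]

theorem finite_slotWords (L : ℕ) :
    {c : SlotWord | c.length ≤ L ∧ ∀ x, some x ∈ c → x ≤ L}.Finite := by
  refine ((List.finite_length_le (Option (Fin (L + 1))) L).image
    (List.map (Option.map Fin.val))).subset fun c hc => ?_
  refine ⟨c.map (Option.map (Fin.ofNat (L + 1))), by simpa using hc.1, ?_⟩
  rw [List.map_map]
  conv_rhs => rw [← List.map_id c]
  refine List.map_congr_left fun o ho => ?_
  cases o with
  | none => rfl
  | some x => simpa using Nat.lt_succ_of_le (hc.2 x ho)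

theorem finite_configurations (L : ℕ) : {c | IsConfiguration c ∧ c.length ≤ L}.Finite := by
  refine (finite_slotWords L).subset fun c hc => ⟨hc.2, fun x hx => ?_⟩
  exact (hc.1.mem_iff.1 hx).2.trans ((List.reduceOption_length_le c).trans hc.2)

theorem finite_permutations (L : ℕ) : {p | IsPermutation p ∧ p.length ≤ L}.Finite := by
  refine ((finite_configurations L).preimage (f := ofPerm) ?_).subset fun p hp =>
    ⟨isConfiguration_ofPerm.2 hp.1, by simpa [ofPerm] using hp.2⟩
  exact (List.map_injective_iff.2 (Option.some_injective ℕ)).injOn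

/-! ## Validity -/

theorem accepts_append {B : Set (List ℕ)} {c d : SlotWord} {w w' : List Letter} (h : Run c w d) :
    Accepts B c (w ++ w') ↔ Accepts B d w' := by
  refine exists_congr fun p => and_congr_right fun _ => ?_
  rw [run_append]
  exact ⟨fun ⟨e, he, hr⟩ => he.unique h ▸ hr, fun hr => ⟨d, h, hr⟩⟩

/-! ## Slots and vertical alternations -/

/-- Whether a symbol is a slot or an entry above `n`. -/
def isHigh (n : ℕ) (o : Option ℕ) : Bool := o.elim true fun x => decide (n < x)

theorem map_isHigh_ofPerm (n : ℕ) (p : List ℕ) :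
    (ofPerm p).map (isHigh n) = p.map fun x => decide (n < x) := by
  simp [ofPerm, isHigh, Function.comp_def]

theorem map_isHigh_block {n x : ℕ} (h : n < x) (o : Op) :
    ∃ k, (o.block x).map (isHigh n) = List.replicate (k + 1) true := by
  cases o
  · exact ⟨2, by simp [Op.block, isHigh, h, List.replicate]⟩
  · exact ⟨1, by simp [Op.block, isHigh, h, List.replicate]⟩
  · exact ⟨1, by simp [Op.block, isHigh, h, List.replicate]⟩
  · exact ⟨0, by simp [Op.block, isHigh, h, List.replicate]⟩

/-- An insertion replaces one letter `true` by a nonempty run of letters `true`. -/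
theorem InsRun.map_isHigh_sublist {c d : SlotWord} {w : List Letter} {m n : ℕ}
    (h : InsRun c w m d) (hn : n ≤ m) : (c.map (isHigh n)).Sublist (d.map (isHigh n)) := by
  induction w generalizing c m with
  | nil => obtain rfl : c = d := h; exact List.Sublist.refl _
  | cons a w ih =>
    obtain ⟨e, ⟨u, v, rfl, -, rfl⟩, h⟩ := h
    refine List.Sublist.trans ?_ (ih h (by omega))
    obtain ⟨k, hk⟩ := map_isHigh_block (show n < m + 1 by omega) a.1
    simp only [List.map_append, List.map_cons, hk, List.append_assoc]
    refine (List.Sublist.refl _).append ?_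
    exact (List.singleton_sublist.2 (by simp [isHigh]) : [isHigh n none].Sublist _).append
      (List.Sublist.refl (v.map (isHigh n)))

/-- An alternating word uses at most one letter of a constant run. Hence undoing an insertion, which
contracts such a run to one letter, destroys no alternating subsequence. -/
theorem sublist_of_isChain_ne {z s t : List Bool} {k : ℕ} (hz : z.IsChain (· ≠ ·))
    (h : z.Sublist (s ++ List.replicate k true ++ t)) : z.Sublist (s ++ true :: t) := by
  rw [List.append_assoc] at h
  obtain ⟨z1, z', rfl, h1, h⟩ := List.sublist_append_iff.1 h
  obtain ⟨z2, z3, rfl, h2, h3⟩ := List.sublist_append_iff.1 h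
  obtain ⟨e, -, rfl⟩ := List.sublist_replicate_iff.1 h2
  refine h1.append ?_
  match e with
  | 0 => exact h3.cons _
  | 1 => exact h3.cons_cons _
  | e + 2 =>
    rw [List.isChain_append] at hz
    exact absurd hz.2.1 (by simp [List.replicate])

theorem InsRun.alternating_sublist {c d : SlotWord} {w : List Letter} {m n : ℕ} {z : List Bool}
    (h : InsRun c w m d) (hn : n ≤ m) (hz : z.IsChain (· ≠ ·)) (hd : z.Sublist (d.map (isHigh n))) :
    z.Sublist (c.map (isHigh n)) := by
  induction w generalizing c m with
  | nil => obtain rfl : c = d := h; exact hd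
  | cons a w ih =>
    obtain ⟨e, ⟨u, v, rfl, -, rfl⟩, h⟩ := h
    obtain ⟨k, hk⟩ := map_isHigh_block (show n < m + 1 by omega) a.1
    have := ih h (by omega)
    simp only [List.map_append, hk] at this
    simpa [isHigh] using sublist_of_isChain_ne hz this

/-- The word in which `true` and `false` alternate. -/
def alternatingWord : ℕ → List Bool
  | 0 => []
  | k + 1 => true :: false :: alternatingWord k

theorem length_alternatingWord (k : ℕ) : (alternatingWord k).length = 2 * k := by
  induction k with
  | zero => rfl
  | succ k ih => simp [alternatingWord, ih]; omega

theorem getElem_alternatingWord (k i : ℕ) (hi : i < (alternatingWord k).length) :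
    (alternatingWord k)[i] = decide (Even i) := by
  induction k generalizing i with
  | zero => simp [alternatingWord] at hi
  | succ k ih =>
    match i with
    | 0 => simp [alternatingWord]
    | 1 => simp [alternatingWord]
    | i + 2 =>
      have := ih i (by simpa [alternatingWord] using hi)
      simpa [alternatingWord, Nat.even_add] using this

/-- Each slot except the last is directly followed by an entry; the last may end the word, whence
the `k + 1`. -/
theorem SlotsApart.alternatingWord_sublist {n k : ℕ} {c : SlotWord} (hc : SlotsApart c)
    (hn : ∀ x, some x ∈ c → x ≤ n) (hk : k + 1 ≤ slots c) :
    (alternatingWord k).Sublist (c.map (isHigh n)) := by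
  match c, k with
  | _, 0 => exact List.nil_sublist _
  | [], k + 1 => simp at hk
  | some x :: c, k + 1 =>
    exact (SlotsApart.alternatingWord_sublist hc.tail (fun y hy => hn y (List.mem_of_mem_tail hy))
      (by simpa using hk)).cons _
  | [none], k + 1 => simp at hk
  | none :: none :: c, k + 1 => exact absurd hc (by simp [SlotsApart])
  | none :: some x :: c, k + 1 =>
    have := SlotsApart.alternatingWord_sublist (n := n) (k := k) hc.tail.tail
      (fun y hy => hn y (List.mem_of_mem_tail (List.mem_of_mem_tail hy))) (by simpa using hk)
    have hx : isHigh n (some x) = false := by simpa [isHigh] using hn x (by simp)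
    simp only [List.map_cons, hx, alternatingWord]
    exact (this.cons_cons _).cons_cons _

/-- A valid configuration with many slots yields a long vertical alternation in the class. -/
theorem IsValid.exists_verticalAlternation {B : Set (List ℕ)} {c : SlotWord} (hc : IsValid B c)
    {k : ℕ} (hk : k + 1 ≤ slots c) :
    ∃ p ∈ Av B, IsVerticalAlternation p ∧ p.length = 2 * k := by
  obtain ⟨hc, w, p, hp, hr⟩ := hc
  set n := c.reduceOption.length
  have h1 := SlotsApart.alternatingWord_sublist (n := n) hc.2 (fun x hx => (hc.mem_iff.1 hx).2) hk
  have h2 := h1.trans ((run_iff_insRun.1 hr).map_isHigh_sublist le_rfl)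
  rw [map_isHigh_ofPerm] at h2
  obtain ⟨s, hs, hsk⟩ := List.sublist_map_iff.1 h2
  have hlen : s.length = 2 * k := by
    rw [← length_alternatingWord, hsk, List.length_map]
  have hperm : IsPermutation (s.map (rank s)) := isPermutation_map_rank (hp.1.nodup.sublist hs)
  have hmono := strictMonoOn_rank s
  have hval : ∀ i (hi : i < s.length), n < s[i] ↔ Even i := fun i hi => by
    have h3 := getElem_alternatingWord k i (by rw [length_alternatingWord]; omega)
    simp only [hsk, List.getElem_map] at h3
    simpa using h3
  refine ⟨s.map (rank s), mem_Av_of_map_sublist hmono hs hp hperm, ⟨hperm, Or.inl ?_⟩,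
    by simpa using hlen⟩
  intro i j hi hj hei hoj
  simp only [List.length_map] at hi hj
  simp only [List.getElem_map]
  refine hmono (List.getElem_mem hj) (List.getElem_mem hi) ?_
  have := (hval i hi).2 hei
  have := mt (hval j hj).1 (by simpa using hoj)
  omega

theorem slots_le_of_finite {B : Set (List ℕ)} (h : {p | p ∈ Av B ∧ IsVerticalAlternation p}.Finite) :
    ∃ k : ℕ, ∀ c, IsValid B c → slots c ≤ k := by
  obtain ⟨k, hk⟩ := (h.image List.length).bddAbove
  refine ⟨k + 1, fun c hc => ?_⟩
  by_contra! hlt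
  obtain ⟨p, hp, hv, hl⟩ := hc.exists_verticalAlternation (k := k + 1) hlt
  have := hk ⟨p, ⟨hp, hv⟩, rfl⟩
  omega

/-- The extra 1 is for words that begin and end with `false`. -/
theorem count_true_of_isChain {z : List Bool} (hz : z.IsChain (· ≠ ·)) :
    z.length ≤ 2 * z.count true + 1 := by
  match z with
  | [] => simp
  | [_] => simp
  | a :: b :: z =>
    have := count_true_of_isChain hz.tail.tail
    have hab := (List.isChain_cons_cons.1 hz).1
    simp only [List.tail] at this
    cases a <;> cases b <;> simp at hab ⊢ <;> omega

theorem IsVerticalAlternation.exists_threshold {p : List ℕ} (h : IsVerticalAlternation p) :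
    ∃ n ≤ p.length, (p.map fun x => decide (n < x)).IsChain (· ≠ ·) := by
  obtain ⟨hp, h⟩ := h
  obtain ⟨b, hb⟩ : ∃ b : Bool, ∀ (i j : ℕ) (hi : i < p.length) (hj : j < p.length),
      decide (Even i) = b → decide (Even j) = !b → p[j] < p[i] := by
    rcases h with h | h
    · exact ⟨true, fun i j hi hj ei ej => h i j hi hj (by simpa using ei) (by simpa using ej)⟩
    · exact ⟨false, fun i j hi hj ei ej => h j i hj hi (by simpa using ej) (by simpa using ei)⟩
  let S : Finset (Fin p.length) := Finset.univ.filter fun j => decide (Even j.1) = !b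
  -- The threshold is the largest entry at an index of the low parity. If there is no such index it
  -- is 0, still below every entry.
  let n := S.sup fun j => p[j.1]
  have key : ∀ i (hi : i < p.length), n < p[i] ↔ decide (Even i) = b := by
    intro i hi
    constructor
    · intro hlt
      by_contra hne
      have hmem : (⟨i, hi⟩ : Fin p.length) ∈ S := by
        simp only [S, Finset.mem_filter, Finset.mem_univ, true_and]
        exact Bool.eq_not.2 hne
      exact absurd (Finset.le_sup (f := fun j : Fin p.length => p[j.1]) hmem) (not_le.2 hlt)
    · intro he
      rw [Finset.sup_lt_iff (hp.mem_iff.1 (List.getElem_mem hi)).1]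
      intro j hj
      exact hb i j.1 hi j.2 he (by simpa [S] using hj)
  refine ⟨n, Finset.sup_le fun j _ => (hp.mem_iff.1 (List.getElem_mem j.2)).2, ?_⟩
  rw [List.isChain_iff_getElem]
  intro i hi
  simp only [List.length_map] at hi
  simp only [List.getElem_map, ne_eq, decide_eq_decide, key, Nat.even_add_one]
  cases b <;> simp <;> rw [← Nat.not_even_iff_odd] <;> tauto

theorem IsVerticalAlternation.exists_isValid {B : Set (List ℕ)} {p : List ℕ}
    (h : IsVerticalAlternation p) (hp : p ∈ Av B) :
    ∃ c, IsValid B c ∧ p.length ≤ 2 * slots c + 1 := by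
  obtain ⟨n, hn, hz⟩ := h.exists_threshold
  obtain ⟨c, w, hc, hcn, hr⟩ := (isConfiguration_ofPerm.2 hp.1).exists_run (j := n) (by simpa)
  refine ⟨c, ⟨hc, w, p, hp, hr⟩, ?_⟩
  have hsub := (run_iff_insRun.1 hr).alternating_sublist (n := n) hcn.ge hz
    (by rw [map_isHigh_ofPerm])
  have hcount := hsub.count_le true
  have hslots : (c.map (isHigh n)).count true = slots c := by
    have hsmall : ∀ x, some x ∈ c → x ≤ n := fun x hx => hcn ▸ (hc.mem_iff.1 hx).2
    clear hsub hcount hr hcn hc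
    induction c with
    | nil => rfl
    | cons o c ih =>
      have ih := ih fun x hx => hsmall x (by simp [hx])
      cases o with
      | none => simp [isHigh, ih]
      | some x =>
        have : isHigh n (some x) = false := by simpa [isHigh] using hsmall x (by simp)
        simp [this, ih]
  have := count_true_of_isChain hz
  simp only [List.length_map] at this
  omega

theorem finite_of_slots_le {B : Set (List ℕ)} {k : ℕ} (h : ∀ c, IsValid B c → slots c ≤ k) :
    {p | p ∈ Av B ∧ IsVerticalAlternation p}.Finite := by
  refine (finite_permutations (2 * k + 1)).subset fun p hp => ⟨hp.1.1, ?_⟩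
  obtain ⟨c, hc, hl⟩ := hp.2.exists_isValid hp.1
  have := h c hc
  omega

/-! ## Reducible entries -/

theorem keep_congr {P Q : ℕ → Bool} {c : SlotWord} (h : ∀ x, some x ∈ c → P x = Q x) :
    keep P c = keep Q c := by
  refine List.filter_congr fun o ho => ?_
  cases o with
  | none => rfl
  | some x => exact h x ho

theorem keep_ne_eq_append {u v : SlotWord} {x : ℕ} (h : (u ++ some x :: v).reduceOption.Nodup) :
    keep (fun y => decide (y ≠ x)) (u ++ some x :: v) = u ++ v := by
  simp only [List.reduceOption_append, List.reduceOption_cons_of_some] at h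
  have hu : ∀ y, some y ∈ u → y ≠ x := fun y hy =>
    (List.nodup_append.1 h).2.2 y (List.reduceOption_mem_iff.2 hy) x (by simp)
  have hv : ∀ y, some y ∈ v → y ≠ x := fun y hy e =>
    (List.nodup_cons.1 (List.nodup_append.1 h).2.1).1 (List.reduceOption_mem_iff.2 (e ▸ hy))
  have key : ∀ t : SlotWord, (∀ y, some y ∈ t → y ≠ x) →
      keep (fun y => decide (y ≠ x)) t = t := fun t ht =>
    List.filter_eq_self.2 fun o ho => by
      cases o with
      | none => rfl
      | some y => simpa using ht y ho
  rw [keep_append, keep_cons_some, key u hu, key v hv]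
  simp

theorem isConfiguration_st {c : SlotWord} (hc : c.reduceOption.Nodup) (h : SlotsApart c) :
    IsConfiguration (st c) := by
  refine ⟨?_, ?_⟩
  · rw [reduceOption_st]
    exact isPermutation_map_rank hc
  · rw [st_eq, List.isChain_map]
    exact h.imp fun a b hab => by simpa using hab

theorem Run.st_keep {c : SlotWord} {w : List Letter} {p : List ℕ} (hc : IsConfiguration c)
    (h : Run c w (ofPerm p)) {P : ℕ → Bool} (hP : ∀ y, c.reduceOption.length < y → P y = true) :
    ∃ f : ℕ → ℕ, StrictMonoOn f {y | y ∈ p.filter P} ∧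
      Run (st (keep P c)) w (ofPerm ((p.filter P).map f)) := by
  have h1 := (run_iff_insRun.1 h).keep hP
  obtain ⟨f, hf, hr⟩ := h1.st fun y hy => by
    rw [reduceOption_keep] at hy
    exact (hc.1.mem_iff.1 (List.mem_of_mem_filter hy)).2
  rw [keep_ofPerm, reduceOption_ofPerm] at hf
  rw [keep_ofPerm, map_ofPerm] at hr
  exact ⟨f, hf, hr⟩

theorem ofPerm_injective : Function.Injective ofPerm :=
  List.map_injective_iff.2 (Option.some_injective ℕ)

/-- An entry is redundant if every small set of entries can be replaced by one that avoids it. -/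
theorem indistinguishable_st_keep {B : Set (List ℕ)} {c : SlotWord} {l x : ℕ}
    (hc : IsConfiguration c) (hB : ∀ q ∈ B, q.length ≤ l) (hx : x ≤ c.reduceOption.length)
    (h : ∀ S : Finset ℕ, S.card ≤ l → ∃ S' : Finset ℕ, x ∉ S' ∧
      st (keep (fun y => decide (y ∈ S')) c) = st (keep (fun y => decide (y ∈ S)) c))
    (hconf : IsConfiguration (st (keep (fun y => decide (y ≠ x)) c))) :
    Indistinguishable B c (st (keep (fun y => decide (y ≠ x)) c)) := by
  set n := c.reduceOption.length with hn
  have hdel : ∀ y, n < y → decide (y ≠ x) = true := fun y hy => by simp; omega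
  intro w
  constructor
  · rintro ⟨p, hp, hr⟩
    obtain ⟨f, hf, hr'⟩ := hr.st_keep hc hdel
    exact ⟨_, mem_Av_of_map_sublist hf List.filter_sublist hp
      (isConfiguration_ofPerm.1 (hconf.run hr')), hr'⟩
  · rintro ⟨q, hq, hr⟩
    -- Since `c` has as many slots as the reduced configuration, `w` can also be run from `c` and
    -- fills all slots. It remains to see that the result `p` avoids `B`.
    obtain ⟨d, hd, hsd⟩ := (run_iff_insRun.1 hr).exists_of_slots_eq (c' := c) n (by simp)
    rw [slots_ofPerm] at hsd
    rw [eq_ofPerm_of_slots hsd] at hd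
    generalize d.reduceOption = p at hd
    replace hd : Run c w (ofPerm p) := run_iff_insRun.2 hd
    refine ⟨p, ⟨isConfiguration_ofPerm.1 (hc.run hd), fun b hb hcon => ?_⟩, hd⟩
    obtain ⟨f, hf, hrf⟩ := hd.st_keep hc hdel
    obtain rfl : q = _ := ofPerm_injective (hr.unique hrf)
    obtain ⟨s, hs, hsb⟩ := hcon
    -- Keep the old entries in S and every entry inserted by `w`.
    let P : Finset ℕ → ℕ → Bool := fun S y => decide (y ∈ S ∨ n < y)
    have hP : ∀ S, keep (P S) c = keep (fun y => decide (y ∈ S)) c := fun S => by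
      refine keep_congr fun y hy => ?_
      have : ¬ n < y := not_lt.2 (hc.mem_iff.1 hy).2
      simp [P, this]
    have hrun : ∀ S, ∃ g : ℕ → ℕ, StrictMonoOn g {y | y ∈ p.filter (P S)} ∧
        Run (st (keep (fun y => decide (y ∈ S)) c)) w (ofPerm ((p.filter (P S)).map g)) :=
      fun S => by
        have := hd.st_keep hc (P := P S) fun y hy => by simp [P, hn, hy]
        rwa [hP] at this
    obtain ⟨S', hxS', hst⟩ := h s.toFinset
      ((List.toFinset_card_le s).trans (hsb.1.trans_le (hB b hb)))
    obtain ⟨g, hg, hrg⟩ := hrun s.toFinset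
    obtain ⟨g', hg', hrg'⟩ := hrun S'
    rw [hst] at hrg'
    -- S and S' leave the same configuration, so `w` completes both to the same permutation. An
    -- occurrence of `b` in `p` can therefore be moved to one that avoids `x`, and it survives in
    -- `q`.
    have heq := ofPerm_injective (hrg.unique hrg')
    have hsP : s.Sublist (p.filter (P s.toFinset)) := by
      have := hs.filter (P s.toFinset)
      rwa [List.filter_eq_self.2 fun y hy => by simp [P, hy]] at this
    have hcon1 : Contains ((p.filter (P s.toFinset)).map g) b :=
      ⟨s.map g, hsP.map g, (orderIsomorphic_map (hg.mono fun y hy => hsP.subset hy)).trans hsb⟩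
    rw [heq] at hcon1
    have hsub : (p.filter (P S')).Sublist (p.filter fun y => decide (y ≠ x)) := by
      refine List.monotone_filter_right p fun y hy => ?_
      simp only [P, decide_eq_true_eq] at hy ⊢
      rintro rfl
      rcases hy with hy | hy
      · exact hxS' hy
      · omega
    have hcon2 := hcon1.of_map_sublist hg' hsub
    obtain ⟨t, ht, htb⟩ := hcon2
    exact hq.2 b hb ⟨t.map f, ht.map f,
      (orderIsomorphic_map (hf.mono fun y hy => ht.subset hy)).trans htb⟩

/-- Few entries are followed by a slot. -/
theorem exists_finset_before_slot (c : SlotWord) :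
    ∃ F : Finset ℕ, F.card ≤ slots c ∧ ∀ u v x, c = u ++ some x :: none :: v → x ∈ F := by
  match c with
  | [] => exact ⟨∅, by simp, by simp⟩
  | none :: c =>
    obtain ⟨F, hF, h⟩ := exists_finset_before_slot c
    refine ⟨F, by simp; omega, fun u v x he => ?_⟩
    match u with
    | [] => simp at he
    | _ :: u => exact h u v x (List.cons.inj he).2
  | [some y] =>
    refine ⟨∅, by simp, fun u v x he => ?_⟩
    have := congrArg List.length he
    simp at this
    omega
  | some y :: some z :: c =>
    obtain ⟨F, hF, h⟩ := exists_finset_before_slot (some z :: c)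
    refine ⟨F, by simpa using hF, fun u v x he => ?_⟩
    match u with
    | [] => simp at he
    | _ :: u => exact h u v x (List.cons.inj he).2
  | some y :: none :: c =>
    obtain ⟨F, hF, h⟩ := exists_finset_before_slot c
    refine ⟨insert y F, (Finset.card_insert_le _ _).trans (by simpa using hF),
      fun u v x he => ?_⟩
    match u with
    | [] => simp at he; simp [he.1]
    | [_] => simp at he
    | _ :: _ :: u =>
      exact Finset.mem_insert_of_mem (h u v x (List.cons.inj (List.cons.inj he).2).2)

theorem exists_ieReducible_of_slots_le {B : Set (List ℕ)} (hfin : B.Finite) {k : ℕ}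
    (hk : ∀ c, IsValid B c → slots c ≤ k) :
    ∃ N : ℕ, ∀ c, IsValid B c → N ≤ c.length → ∃ i, IEReducible B c i := by
  classical
  obtain ⟨l, hl⟩ := (hfin.image List.length).bddAbove
  have hB : ∀ q ∈ B, q.length ≤ l := fun q hq => hl ⟨q, hq, rfl⟩
  -- `T` contains every type: at most k slots and at most l entries, whose ranks are at most l.
  set T := (finite_slotWords (k + l)).toFinset
  -- At most k symbols are slots, the representatives cover at most `T.card * l` entries, and at
  -- most k entries precede a slot; one more entry is needed.
  refine ⟨k + (T.card * l + k) + 1, fun c hv hN => ?_⟩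
  have hck := hk c hv
  have hc := hv.1
  set n := c.reduceOption.length with hn
  have hcard : T.card * l + k < n := by
    have := length_eq_slots_add c
    omega
  let R : SlotWord → Finset ℕ → Prop := fun t S =>
    S.card ≤ l ∧ st (keep (fun y => decide (y ∈ S)) c) = t
  -- Words that are not types of `c` get the empty set, so that the cardinality bound holds for all
  -- of `T`.
  have hsel : ∀ t, ∃ S : Finset ℕ, S.card ≤ l ∧ ((∃ S', R t S') → R t S) := fun t => by
    by_cases h : ∃ S', R t S'
    · obtain ⟨S, hS⟩ := h
      exact ⟨S, hS.1, fun _ => hS⟩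
    · exact ⟨∅, by simp, fun h' => absurd h' h⟩
  choose sel hsel1 hsel2 using hsel
  obtain ⟨F, hF, hF'⟩ := exists_finset_before_slot c
  have hU : (T.biUnion sel ∪ F).card < (Finset.Icc 1 n).card := by
    refine (Finset.card_union_le _ _).trans_lt ?_
    have := Finset.card_biUnion_le_card_mul T sel l fun t _ => hsel1 t
    rw [Nat.card_Icc]
    omega
  obtain ⟨x, hx, hxU⟩ := Finset.exists_mem_notMem_of_card_lt_card hU
  rw [Finset.mem_Icc] at hx
  rw [Finset.mem_union, Finset.mem_biUnion] at hxU
  push Not at hxU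
  obtain ⟨hxT, hxF⟩ := hxU
  obtain ⟨u, v, hdec⟩ := List.append_of_mem (hc.mem_iff.2 hx)
  have herase : c.eraseIdx u.length = keep (fun y => decide (y ≠ x)) c := by
    have hnd := hc.1.nodup
    rw [hdec] at hnd ⊢
    rw [keep_ne_eq_append hnd, List.eraseIdx_append_of_length_le le_rfl]
    simp
  have hconf : IsConfiguration (st (keep (fun y => decide (y ≠ x)) c)) := by
    refine isConfiguration_st ?_ ?_
    · rw [reduceOption_keep]
      exact hc.1.nodup.filter _
    · have hnd := hc.1.nodup
      rw [hdec] at hnd ⊢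
      rw [keep_ne_eq_append hnd]
      obtain ⟨hu, hv⟩ := slotsApart_append_some.1 (hdec ▸ hc.2)
      -- Deleting `x` could make two slots adjacent only if a slot followed `x`, which `F` excludes.
      match v, hv with
      | [], _ => simpa using hu
      | some y :: v, hv =>
        exact slotsApart_append_some.2 ⟨hu, (slotsApart_append_some (u := [])).1 hv |>.2⟩
      | none :: v, _ => exact absurd (hF' u v x hdec) hxF
  refine ⟨u.length, ⟨x, by simp [hdec]⟩, by rwa [herase], ?_⟩
  rw [herase]
  refine indistinguishable_st_keep hc hB hx.2 (fun S hS => ?_) hconf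
  set t := st (keep (fun y => decide (y ∈ S)) c) with ht
  have hR := hsel2 t ⟨S, hS, rfl⟩
  refine ⟨sel t, hxT t ?_, hR.2⟩
  have hfil : (c.reduceOption.filter fun y => decide (y ∈ S)).length ≤ l := by
    refine le_trans ?_ hS
    rw [← List.toFinset_card_of_nodup (hc.1.nodup.filter _)]
    exact Finset.card_le_card fun y hy => by simpa using (List.mem_filter.1 (List.mem_toFinset.1 hy)).2
  simp only [T, Set.Finite.mem_toFinset, Set.mem_ofPred_eq]
  refine ⟨?_, fun y hy => ?_⟩
  · rw [length_eq_slots_add t, ht, reduceOption_st]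
    simp only [slots_st, slots_keep, List.length_map, reduceOption_keep]
    omega
  · rw [← List.reduceOption_mem_iff, ht, reduceOption_st, List.mem_map] at hy
    obtain ⟨z, hz, rfl⟩ := hy
    have := rank_le_length hz
    rw [reduceOption_keep] at this ⊢
    omega

/-! ## Regularity -/

theorem IEReducible.slots_eq {B : Set (List ℕ)} {c : SlotWord} {i : ℕ} (h : IEReducible B c i) :
    slots (st (c.eraseIdx i)) = slots c ∧ (st (c.eraseIdx i)).length < c.length := by
  obtain ⟨⟨x, hx⟩, -⟩ := h
  obtain ⟨hi, hx⟩ := List.getElem?_eq_some_iff.1 hx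
  have hlen : (st (c.eraseIdx i)).length + 1 = c.length := by
    rw [st_eq, List.length_map, List.length_eraseIdx_of_lt hi]
    omega
  refine ⟨?_, by omega⟩
  have hperm := (List.getElem_cons_eraseIdx_perm hi).count_eq none
  rw [slots_st, slots, slots, ← hperm, hx]
  simp

/-- Removing reducible entries makes every valid configuration short. -/
theorem IsValid.exists_short {B : Set (List ℕ)} {N : ℕ}
    (h : ∀ c, IsValid B c → N ≤ c.length → ∃ i, IEReducible B c i) {c : SlotWord}
    (hc : IsValid B c) :
    ∃ c', IsConfiguration c' ∧ c'.length ≤ N ∧ slots c' = slots c ∧ Indistinguishable B c c' := by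
  by_cases hN : N ≤ c.length
  · obtain ⟨i, hi⟩ := h c hc hN
    have hlt := hi.slots_eq.2
    have hv : IsValid B (st (c.eraseIdx i)) :=
      ⟨hi.2.1, hc.2.imp fun w hw => (hi.2.2 w).1 hw⟩
    obtain ⟨c', h1, h2, h3, h4⟩ := hv.exists_short h
    exact ⟨c', h1, h2, h3.trans hi.slots_eq.1, fun w => (hi.2.2 w).trans (h4 w)⟩
  · exact ⟨c, hc.1, by omega, rfl, fun w => Iff.rfl⟩
termination_by c.length

/-- Deleting entries preserves the number of slots, which the final short configuration bounds by
its length. -/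
theorem slots_le_of_exists_ieReducible {B : Set (List ℕ)} {N : ℕ}
    (h : ∀ c, IsValid B c → N ≤ c.length → ∃ i, IEReducible B c i) :
    ∀ c, IsValid B c → slots c ≤ N := by
  intro c hc
  obtain ⟨c', -, hl, hs, -⟩ := hc.exists_short h
  have := length_eq_slots_add c'
  omega

theorem mem_insertionEncoding {B : Set (List ℕ)} {w : List Letter} :
    w ∈ insertionEncoding B ↔ Accepts B [none] w := Iff.rfl

theorem mem_insertionEncoding_append {B : Set (List ℕ)} {w w' : List Letter} :
    w ++ w' ∈ insertionEncoding B ↔ ∃ c, IsConfiguration c ∧ Run [none] w c ∧ Accepts B c w' := by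
  rw [mem_insertionEncoding]
  constructor
  · rintro ⟨p, hp, hr⟩
    obtain ⟨c, hc, hr⟩ := run_append.1 hr
    exact ⟨c, isConfiguration_slot.run hc, hc, p, hp, hr⟩
  · rintro ⟨c, -, hr, ha⟩
    exact (accepts_append hr).2 ha

theorem isRegularOverFinite_of_exists_ieReducible {B : Set (List ℕ)} {N : ℕ}
    (h : ∀ c, IsValid B c → N ≤ c.length → ∃ i, IEReducible B c i) :
    IsRegularOverFinite (insertionEncoding B) := by
  let A : Finset Letter := ({Op.m, Op.l, Op.r, Op.f} : Finset Op) ×ˢ Finset.range (N + 1)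
  let M : Language A := {w | w.map Subtype.val ∈ insertionEncoding B}
  have hmem : ∀ w, w ∈ M ↔ w.map Subtype.val ∈ insertionEncoding B := fun w => Iff.rfl
  refine ⟨A, M, ?_, ?_⟩
  · rw [Language.isRegular_iff_finite_range_leftQuotient]
    let Q : SlotWord → Language A := fun c => {w | Accepts B c (w.map Subtype.val)}
    have hQ : ∀ c w, w ∈ Q c ↔ Accepts B c (w.map Subtype.val) := fun c w => Iff.rfl
    -- A nonempty left quotient by `w` is the language accepted from the configuration that `w`
    -- reaches, hence also from a short indistinguishable one. All other quotients are empty.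
    refine (((finite_configurations N).image Q).insert (0 : Language A)).subset ?_
    rintro _ ⟨w, rfl⟩
    by_cases hne : ∃ w', w' ∈ M.leftQuotient w
    · right
      obtain ⟨w', hw'⟩ := hne
      rw [Language.mem_leftQuotient, hmem, List.map_append, mem_insertionEncoding_append] at hw'
      obtain ⟨c, hc, hr, ha⟩ := hw'
      have hv : IsValid B c := ⟨hc, _, ha⟩
      obtain ⟨c', hc', hl, -, hi⟩ := hv.exists_short h
      refine ⟨c', ⟨hc', hl⟩, ?_⟩
      ext w''
      rw [Language.mem_leftQuotient, hmem, List.map_append, mem_insertionEncoding,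
        accepts_append hr, hQ]
      exact (hi _).symm
    · left
      push Not at hne
      ext w'
      exact iff_of_false (hne w') (Language.notMem_zero w')
  · ext w
    constructor
    · rintro ⟨w, hw, rfl⟩
      exact hw
    · intro hw
      have hA : ∀ a ∈ w, a ∈ A := by
        intro a ha
        obtain ⟨w1, w2, rfl⟩ := List.append_of_mem ha
        obtain ⟨c, hc, -, hacc⟩ := mem_insertionEncoding_append.1 hw
        -- The configuration in which a letter is used is valid, so the slot number of that letter
        -- is at most `N`.
        have hk := slots_le_of_exists_ieReducible h c ⟨hc, _, hacc⟩
        obtain ⟨p, -, e, ⟨u, v, rfl, hu, -⟩, -⟩ := hacc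
        simp only [slots_append, slots_cons_none] at hk
        refine Finset.mem_product.2 ⟨?_, Finset.mem_range.2 (by omega)⟩
        cases a.1 <;> simp
      lift w to List A using hA
      exact ⟨w, hw, rfl⟩

theorem slots_le_of_isRegularOverFinite {B : Set (List ℕ)}
    (h : IsRegularOverFinite (insertionEncoding B)) :
    ∃ k : ℕ, ∀ c, IsValid B c → slots c ≤ k := by
  obtain ⟨A, M, hM, hL⟩ := h
  have hmem : ∀ w : List A, w.map Subtype.val ∈ insertionEncoding B ↔ w ∈ M := fun w => by
    rw [← hL]
    refine ⟨?_, fun hw => ⟨w, hw, rfl⟩⟩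
    rintro ⟨w', hw', he⟩
    rwa [← List.map_injective_iff.2 Subtype.val_injective he]
  rw [Language.isRegular_iff_finite_range_leftQuotient] at hM
  -- `k` bounds the length of a shortest word in each quotient. For an empty quotient `sInf` is 0,
  -- which does no harm, as the quotients used below are nonempty.
  obtain ⟨k, hk⟩ := (hM.image fun Q : Language A => sInf (List.length '' {w | w ∈ Q})).bddAbove
  refine ⟨k, fun c hc => ?_⟩
  obtain ⟨hconf, w2, hacc⟩ := hc
  by_cases hnil : c = []
  · simp [hnil]
  obtain ⟨w1, hr⟩ := hconf.reachable hnil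
  have hw : w1 ++ w2 ∈ insertionEncoding B := (accepts_append hr).2 hacc
  rw [← hL] at hw
  obtain ⟨w, hw, he⟩ := hw
  obtain ⟨w1, w2, rfl, rfl, rfl⟩ := List.map_eq_append_iff.1 he
  have hne : (List.length '' {w | w ∈ M.leftQuotient w1}).Nonempty :=
    ⟨_, w2, (Language.mem_leftQuotient _ _).2 hw, rfl⟩
  obtain ⟨w', hw', hlen⟩ := Nat.sInf_mem hne
  have hle : w'.length ≤ k := by
    rw [hlen]
    exact hk ⟨_, ⟨w1, rfl⟩, rfl⟩
  have hin := (hmem _).2 ((Language.mem_leftQuotient _ _).1 hw')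
  rw [List.map_append, mem_insertionEncoding, accepts_append hr] at hin
  obtain ⟨p, -, hp⟩ := hin
  have := (run_iff_insRun.1 hp).slots_le
  simp only [slots_ofPerm, List.length_map] at this
  omega

end InsEnc

theorem theorem2 (B : Set (List ℕ)) (hfin : B.Finite)
    (hB : ∀ q ∈ B, InsEnc.IsPermutation q) :
    List.TFAE [
      {p | p ∈ InsEnc.Av B ∧ InsEnc.IsVerticalAlternation p}.Finite,
      ∃ k : ℕ, ∀ c, InsEnc.IsValid B c → InsEnc.slots c ≤ k,
      ∃ N : ℕ, ∀ c, InsEnc.IsValid B c → N ≤ c.length → ∃ i, InsEnc.IEReducible B c i,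
      InsEnc.IsRegularOverFinite (InsEnc.insertionEncoding B)] := by
  tfae_have 1 → 2 := InsEnc.slots_le_of_finite
  tfae_have 2 → 1 := fun ⟨_, h⟩ => InsEnc.finite_of_slots_le h
  tfae_have 2 → 3 := fun ⟨_, h⟩ => InsEnc.exists_ieReducible_of_slots_le hfin h
  tfae_have 3 → 4 := fun ⟨_, h⟩ => InsEnc.isRegularOverFinite_of_exists_ieReducible h
  tfae_have 4 → 2 := InsEnc.slots_le_of_isRegularOverFinite
  tfae_finish
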